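/- Let $(\Omega,\mu)$ be an atomless finite measure space and let $p(\cdot):\Omega\to[1,\infty)$ be a measurable function (an exponent). Let $L^{p(\cdot)}(\mu)$ be the variable Lebesgue space of all classes of real measurable functions $f$ on $\Omega$ such that $\int_\Omega |f(t)/r|^{p(t)}\,d\mu<\infty$ for some $r>0$, equipped with the Luxemburg norm $$\|f\|_{p(\cdot)}=\inf\Big\{r>0:\int_\Omega |f(t)/r|^{p(t)}\,d\mu\le 1\Big\}.$$ For a measurable function $f:\Omega\to[0,\infty]$ let $f^*(x)=\inf\{s\ge 0:\mu(\{t\in\Omega: f(t)>s\})\le x\}$, $0\le x<\mu(\Omega)$, be its decreasing rearrangement (with $\inf\emptyset=\infty$). Put $\frac{p}{p-1}=\infty$ where $p=1$, and $a^\infty=\infty$ for $a>1$. Then the following statements are equivalent. 1. $\displaystyle\int_0^{\mu(\Omega)} a^{\left(\frac{p}{p-1}\right)^*(x)}\,dx<\infty$ for every $a>1$. 2. The inclusion $L^{p(\cdot)}(\mu)\hookrightarrow L^1(\mu)$ is weakly compact, i.e. it maps the closed unit ball to a relatively weakly compact subset of $L^1(\mu)$. 3. The inclusion $L^{p(\cdot)}(\mu)\hookrightarrow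 L^1(\mu)$ is disjointly strictly singular (DSS), i.e. for no normalized sequence $(f_n)$ of pairwise disjoint functions in $L^{p(\cdot)}(\mu)$ is its restriction to the closed linear span of $(f_n)$ an isomorphism onto its image. 4. $\displaystyle\lim_{x\to\mu(\Omega)^-}(\mu(\Omega)-x)^{\left(\frac{p-1}{p}\right)^*(x)}=0$, the limit being taken over $x\in[0,\mu(\Omega))$ (and understood as vacuously true if $\mu(\Omega)=0$). -/

import Mathlib

open MeasureTheory Filter Topology Set
open scoped ENNReal

noncomputable section

/-- A measure is *atomless* if every measurable set of positive measure has a measurable subset of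
strictly smaller positive measure. -/
def IsAtomless {Ω : Type*} [MeasurableSpace Ω] (μ : Measure Ω) : Prop :=
  ∀ s : Set Ω, MeasurableSet s → 0 < μ s →
    ∃ t : Set Ω, t ⊆ s ∧ MeasurableSet t ∧ 0 < μ t ∧ μ t < μ s

/-- An *exponent* on `Ω`: a real measurable function `p` with `1 ≤ p t < ∞`. -/
structure Exponent (Ω : Type*) [MeasurableSpace Ω] where
  toFun : Ω → ℝ
  measurable : Measurable toFun
  one_le : ∀ t, 1 ≤ toFun t

instance {Ω : Type*} [MeasurableSpace Ω] : CoeFun (Exponent Ω) (fun _ => Ω → ℝ) := ⟨Exponent.toFun⟩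

namespace VarLebesgue

section Modular

variable {Ω : Type*} [MeasurableSpace Ω]

/-- The modular `ρ_p(f) = ∫ |f(t)|^{p(t)} dμ`. -/
def modular (p : Exponent Ω) (μ : Measure Ω) (f : Ω → ℝ) : ℝ≥0∞ :=
  ∫⁻ t, ‖f t‖ₑ ^ p t ∂μ

/-- The scalings `r > 0` with `ρ_p(f / r) ≤ 1`. -/
def admissible (p : Exponent Ω) (μ : Measure Ω) (f : Ω → ℝ) : Set ℝ :=
  {r : ℝ | 0 < r ∧ modular p μ (fun t => f t / r) ≤ 1}

/-- The Luxemburg norm `inf {r > 0 : ρ_p(f / r) ≤ 1}`. -/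
def luxemburg (p : Exponent Ω) (μ : Measure Ω) (f : Ω → ℝ) : ℝ :=
  sInf (admissible p μ f)

variable {p : Exponent Ω} {μ : Measure Ω} {f g : Ω → ℝ} {r s : ℝ}

lemma modular_congr (h : f =ᵐ[μ] g) : modular p μ f = modular p μ g :=
  lintegral_congr_ae (h.mono fun t ht => by simp only [ht])

lemma modular_div_congr (h : f =ᵐ[μ] g) (r : ℝ) :
    modular p μ (fun t => f t / r) = modular p μ (fun t => g t / r) :=
  modular_congr (h.mono fun t ht => by simp only [ht])

lemma admissible_congr (h : f =ᵐ[μ] g) : admissible p μ f = admissible p μ g := by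
  ext r
  simp only [admissible, mem_ofPred_eq, modular_div_congr h r]

lemma modular_mono (h : ∀ t, |f t| ≤ |g t|) : modular p μ f ≤ modular p μ g :=
  lintegral_mono fun t => ENNReal.rpow_le_rpow
    (by rw [enorm_le_iff_norm_le]; exact h t) (zero_le_one.trans (p.one_le t))

lemma modular_div_anti (hr : 0 < r) (hrs : r ≤ s) :
    modular p μ (fun t => f t / s) ≤ modular p μ (fun t => f t / r) := by
  apply modular_mono
  intro t
  rw [abs_div, abs_div, abs_of_pos hr, abs_of_pos (hr.trans_le hrs)]
  gcongr

/-- Convexity gives `ρ_p(c f) ≤ c ρ_p(f)` for `0 ≤ c ≤ 1`. -/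
lemma modular_mul_le {c : ℝ} (hc : 0 ≤ c) (hc1 : c ≤ 1) :
    modular p μ (fun t => c * f t) ≤ ENNReal.ofReal c * modular p μ f := by
  unfold modular
  rw [← lintegral_const_mul' _ _ ENNReal.ofReal_ne_top]
  apply lintegral_mono
  intro t
  have hp := p.one_le t
  simp only [enorm_mul]
  rw [ENNReal.mul_rpow_of_nonneg _ _ (zero_le_one.trans hp), Real.enorm_of_nonneg hc]
  gcongr
  calc ENNReal.ofReal c ^ p t ≤ ENNReal.ofReal c ^ (1 : ℝ) :=
        ENNReal.rpow_le_rpow_of_exponent_ge (by simpa using hc1) hp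
    _ = ENNReal.ofReal c := ENNReal.rpow_one _

lemma modular_aemeasurable (hf : AEStronglyMeasurable f μ) :
    AEMeasurable (fun t => ‖f t‖ₑ ^ p t) μ :=
  hf.enorm.pow p.measurable.aemeasurable

lemma modular_add_div_le (hf : AEStronglyMeasurable f μ) (hr : 0 < r) (hs : 0 < s) :
    modular p μ (fun t => (f t + g t) / (r + s)) ≤
      ENNReal.ofReal (r / (r + s)) * modular p μ (fun t => f t / r) +
        ENNReal.ofReal (s / (r + s)) * modular p μ (fun t => g t / s) := by
  unfold modular
  have hrs : 0 < r + s := add_pos hr hs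
  rw [← lintegral_const_mul' _ _ ENNReal.ofReal_ne_top,
    ← lintegral_const_mul' _ _ ENNReal.ofReal_ne_top,
    ← lintegral_add_left' ((modular_aemeasurable (by fun_prop)).const_mul _)]
  apply lintegral_mono
  intro t
  have hw : ENNReal.ofReal (r / (r + s)) + ENNReal.ofReal (s / (r + s)) = 1 := by
    rw [← ENNReal.ofReal_add (by positivity) (by positivity), ← add_div, div_self hrs.ne']
    simp
  refine le_trans (ENNReal.rpow_le_rpow ?_ (zero_le_one.trans (p.one_le t)))
    (ENNReal.rpow_arith_mean_le_arith_mean2_rpow _ _ _ _ hw (p.one_le t))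
  have e : (f t + g t) / (r + s) = (r / (r + s)) * (f t / r) + (s / (r + s)) * (g t / s) := by
    field_simp
  show ‖(f t + g t) / (r + s)‖ₑ ≤ _
  rw [e]
  refine (enorm_add_le _ _).trans (le_of_eq ?_)
  rw [enorm_mul, enorm_mul, Real.enorm_of_nonneg (by positivity : 0 ≤ r / (r + s)),
    Real.enorm_of_nonneg (by positivity : 0 ≤ s / (r + s))]

lemma admissible_bddBelow : BddBelow (admissible p μ f) := ⟨0, fun _ h => h.1.le⟩

lemma luxemburg_nonneg : 0 ≤ luxemburg p μ f := Real.sInf_nonneg fun _ h => h.1.le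

lemma admissible_nonempty (h : ∃ r : ℝ, 0 < r ∧ modular p μ (fun t => f t / r) < ∞) :
    (admissible p μ f).Nonempty := by
  obtain ⟨r, hr, h⟩ := h
  set M := (modular p μ (fun t => f t / r)).toReal with hM
  have hM0 : 0 ≤ M := ENNReal.toReal_nonneg
  refine ⟨(1 + M) * r, by positivity, ?_⟩
  have e : (fun t => f t / ((1 + M) * r)) = fun t => (1 + M)⁻¹ * (f t / r) := by
    ext t; field_simp
  rw [e]
  refine (modular_mul_le (by positivity) (inv_le_one_of_one_le₀ (by linarith))).trans ?_
  rw [← ENNReal.ofReal_toReal h.ne, ← hM, ← ENNReal.ofReal_mul (by positivity)]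
  apply ENNReal.ofReal_le_one.2
  rw [inv_mul_le_iff₀ (by positivity)]
  linarith

lemma admissible_add (hf : AEStronglyMeasurable f μ) (hr : r ∈ admissible p μ f)
    (hs : s ∈ admissible p μ g) : r + s ∈ admissible p μ (fun t => f t + g t) := by
  have h0 : 0 < r + s := add_pos hr.1 hs.1
  refine ⟨h0, (modular_add_div_le hf hr.1 hs.1).trans ?_⟩
  calc _ ≤ ENNReal.ofReal (r / (r + s)) * 1 + ENNReal.ofReal (s / (r + s)) * 1 := by
        gcongr
        · exact hr.2
        · exact hs.2
    _ = 1 := by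
        have h1 := hr.1
        have h2 := hs.1
        rw [mul_one, mul_one, ← ENNReal.ofReal_add (by positivity) (by positivity), ← add_div,
          div_self h0.ne', ENNReal.ofReal_one]

lemma admissible_smul {c : ℝ} (hc : c ≠ 0) (hr : r ∈ admissible p μ f) :
    |c| * r ∈ admissible p μ (fun t => c * f t) := by
  have hc' : 0 < |c| := abs_pos.2 hc
  have h1 := hr.1
  refine ⟨by positivity, le_trans (modular_mono fun t => le_of_eq ?_) hr.2⟩
  rw [abs_div, abs_div, abs_mul, abs_mul, abs_abs]
  field_simp

lemma luxemburg_add_le (hf : AEStronglyMeasurable f μ) (hf' : (admissible p μ f).Nonempty)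
    (hg' : (admissible p μ g).Nonempty) :
    luxemburg p μ (fun t => f t + g t) ≤ luxemburg p μ f + luxemburg p μ g := by
  apply le_of_forall_pos_le_add
  intro ε hε
  obtain ⟨r, hr, hr'⟩ := Real.lt_sInf_add_pos hf' (half_pos hε)
  obtain ⟨s, hs, hs'⟩ := Real.lt_sInf_add_pos hg' (half_pos hε)
  have := csInf_le admissible_bddBelow (admissible_add hf hr hs)
  unfold luxemburg
  linarith

lemma luxemburg_smul_le {c : ℝ} (hc : c ≠ 0) (hf' : (admissible p μ f).Nonempty) :
    luxemburg p μ (fun t => c * f t) ≤ |c| * luxemburg p μ f := by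
  have hc' : 0 < |c| := abs_pos.2 hc
  rw [← div_le_iff₀' hc']
  apply le_csInf hf'
  intro r hr
  rw [div_le_iff₀' hc']
  exact csInf_le admissible_bddBelow (admissible_smul hc hr)

lemma luxemburg_zero : luxemburg p μ (fun _ => 0) = 0 := by
  have key : ∀ r : ℝ, 0 < r → r ∈ admissible p μ (fun _ => (0 : ℝ)) := by
    intro r hr
    refine ⟨hr, ?_⟩
    have h : ∀ t, (0 : ℝ≥0∞) ^ p t = 0 := fun t =>
      ENNReal.zero_rpow_of_pos (zero_lt_one.trans_le (p.one_le t))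
    simp [modular, h]
  refine le_antisymm (le_of_forall_pos_le_add fun ε hε => ?_) luxemburg_nonneg
  rw [zero_add]
  exact csInf_le admissible_bddBelow (key ε hε)

lemma luxemburg_congr (h : f =ᵐ[μ] g) : luxemburg p μ f = luxemburg p μ g := by
  unfold luxemburg
  rw [admissible_congr h]

lemma ae_eq_zero_of_luxemburg (hf : AEStronglyMeasurable f μ)
    (hf' : (admissible p μ f).Nonempty) (h : luxemburg p μ f = 0) : f =ᵐ[μ] 0 := by
  have small : ∀ ε : ℝ, 0 < ε → ε ≤ 1 → modular p μ f ≤ ENNReal.ofReal ε := by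
    intro ε hε hε1
    obtain ⟨r, hr, hr'⟩ := Real.lt_sInf_add_pos hf' hε
    have hlt : r < ε := by
      have : sInf (admissible p μ f) = 0 := h
      linarith
    have hε' : modular p μ (fun t => f t / ε) ≤ 1 := (modular_div_anti hr.1 hlt.le).trans hr.2
    have e : f = fun t => ε * (f t / ε) := by ext t; field_simp
    calc modular p μ f = modular p μ (fun t => ε * (f t / ε)) := by rw [← e]
      _ ≤ ENNReal.ofReal ε * modular p μ (fun t => f t / ε) := modular_mul_le hε.le hε1
      _ ≤ ENNReal.ofReal ε * 1 := by gcongr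
      _ = ENNReal.ofReal ε := mul_one _
  have hz : modular p μ f = 0 := by
    have lim : Tendsto (fun ε : ℝ => ENNReal.ofReal ε) (𝓝[>] 0) (𝓝 0) := by
      have := (ENNReal.continuous_ofReal.tendsto 0).mono_left
        (nhdsWithin_le_nhds (s := Ioi (0 : ℝ)))
      simpa using this
    refine le_antisymm (ge_of_tendsto lim ?_) (zero_le)
    filter_upwards [Ioc_mem_nhdsGT (zero_lt_one' ℝ)] with ε hε
    exact small ε hε.1 hε.2
  unfold modular at hz
  rw [lintegral_eq_zero_iff' (modular_aemeasurable hf)] at hz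
  filter_upwards [hz] with t ht
  have hp : 0 < p t := zero_lt_one.trans_le (p.one_le t)
  have : ‖f t‖ₑ ^ p t = 0 := ht
  rw [ENNReal.rpow_eq_zero_iff_of_pos hp] at this
  simpa using this

end Modular

end VarLebesgue

open VarLebesgue in
/-- The variable Lebesgue space `L^{p(·)}(μ)`: classes of measurable functions `f` with
`ρ_p(f / r) < ∞` for some `r > 0`. -/
def VarLp {Ω : Type*} [MeasurableSpace Ω] (p : Exponent Ω) (μ : Measure Ω) :
    Submodule ℝ (Ω →ₘ[μ] ℝ) where
  carrier := {f | ∃ r : ℝ, 0 < r ∧ modular p μ (fun t => f t / r) < ∞}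
  zero_mem' := by
    refine ⟨1, one_pos, ?_⟩
    have h : ∀ t, (0 : ℝ≥0∞) ^ p t = 0 := fun t =>
      ENNReal.zero_rpow_of_pos (zero_lt_one.trans_le (p.one_le t))
    have h0 : (⇑(0 : Ω →ₘ[μ] ℝ)) =ᵐ[μ] fun _ => (0 : ℝ) := AEEqFun.coeFn_zero
    rw [modular_div_congr h0]
    simp [modular, h]
  add_mem' := by
    intro f g hf hg
    obtain ⟨r, hr⟩ := admissible_nonempty hf
    obtain ⟨s, hs⟩ := admissible_nonempty hg
    have := admissible_add f.aestronglyMeasurable hr hs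
    refine ⟨r + s, this.1, ?_⟩
    have e : ⇑(f + g) =ᵐ[μ] fun t => f t + g t := AEEqFun.coeFn_add f g
    rw [modular_div_congr e]
    exact this.2.trans_lt ENNReal.one_lt_top
  smul_mem' := by
    intro c f hf
    have e : ⇑(c • f) =ᵐ[μ] fun t => c * f t := AEEqFun.coeFn_smul c f
    obtain ⟨r, hr⟩ := admissible_nonempty hf
    have h1 := admissible_smul (c := |c| + 1) (by positivity) hr
    refine ⟨_, h1.1, ?_⟩
    rw [modular_div_congr e]
    refine lt_of_le_of_lt (modular_mono fun t => ?_) (h1.2.trans_lt ENNReal.one_lt_top)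
    have hc : 0 ≤ |c| + 1 := by positivity
    show |c * f t / (abs (|c| + 1) * r)| ≤ |(|c| + 1) * f t / (abs (|c| + 1) * r)|
    rw [abs_div, abs_div, abs_mul c, abs_mul (|c| + 1) (f t), abs_of_nonneg hc]
    gcongr
    linarith

namespace VarLp

open VarLebesgue

variable {Ω : Type*} [MeasurableSpace Ω] {p : Exponent Ω} {μ : Measure Ω}

lemma nonempty (f : VarLp p μ) : (admissible p μ f.1).Nonempty := admissible_nonempty f.2

instance instNorm : Norm (VarLp p μ) := ⟨fun f => luxemburg p μ f.1⟩

lemma norm_def (f : VarLp p μ) : ‖f‖ = luxemburg p μ f.1 := rfl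

lemma norm_smul_le' (c : ℝ) (f : VarLp p μ) (hc : c ≠ 0) : ‖c • f‖ ≤ |c| * ‖f‖ := by
  have e : ⇑((c • f : VarLp p μ) : Ω →ₘ[μ] ℝ) =ᵐ[μ] fun t => c * f.1 t :=
    AEEqFun.coeFn_smul c f.1
  rw [norm_def, luxemburg_congr e]
  exact luxemburg_smul_le hc (nonempty f)

lemma norm_zero' : ‖(0 : VarLp p μ)‖ = 0 := by
  have e : ⇑((0 : VarLp p μ) : Ω →ₘ[μ] ℝ) =ᵐ[μ] fun _ => (0 : ℝ) := AEEqFun.coeFn_zero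
  rw [norm_def, luxemburg_congr e]
  exact luxemburg_zero

lemma normCore : NormedSpace.Core ℝ (VarLp p μ) where
  norm_nonneg _ := luxemburg_nonneg
  norm_smul c f := by
    rcases eq_or_ne c 0 with rfl | hc
    · rw [zero_smul, norm_zero', norm_zero, zero_mul]
    · refine le_antisymm (norm_smul_le' c f hc) ?_
      have h := norm_smul_le' c⁻¹ (c • f) (inv_ne_zero hc)
      rw [smul_smul, inv_mul_cancel₀ hc, one_smul, abs_inv] at h
      rw [Real.norm_eq_abs]
      have hc' : 0 < |c| := abs_pos.2 hc
      rwa [← div_eq_inv_mul, le_div_iff₀' hc'] at h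
  norm_triangle f g := by
    have e : ⇑((f + g : VarLp p μ) : Ω →ₘ[μ] ℝ) =ᵐ[μ] fun t => f.1 t + g.1 t :=
      AEEqFun.coeFn_add f.1 g.1
    rw [norm_def, luxemburg_congr e]
    exact luxemburg_add_le f.1.aestronglyMeasurable (nonempty f) (nonempty g)
  norm_eq_zero_iff f := by
    constructor
    · intro h
      have := ae_eq_zero_of_luxemburg f.1.aestronglyMeasurable (nonempty f) h
      exact Subtype.ext (AEEqFun.ext (this.trans AEEqFun.coeFn_zero.symm))
    · rintro rfl
      exact norm_zero'

/-- `L^{p(·)}(μ)` with the Luxemburg norm. -/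
instance instNormedAddCommGroup : NormedAddCommGroup (VarLp p μ) :=
  NormedAddCommGroup.ofCore normCore

instance instNormedSpace : NormedSpace ℝ (VarLp p μ) := NormedSpace.ofCore normCore

section Inclusion

variable [IsFiniteMeasure μ]

lemma lintegral_le_of_admissible (f : Ω → ℝ) {r : ℝ} (hr : r ∈ admissible p μ f) :
    ∫⁻ t, ‖f t‖ₑ ∂μ ≤ ENNReal.ofReal ((μ.real univ + 1) * r) := by
  have h0 := hr.1
  have step : ∫⁻ t, ‖f t / r‖ₑ ∂μ ≤ μ univ + 1 := by
    calc ∫⁻ t, ‖f t / r‖ₑ ∂μ ≤ ∫⁻ t, (1 + ‖f t / r‖ₑ ^ p t) ∂μ := by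
          apply lintegral_mono
          intro t
          simp only
          rcases le_total ‖f t / r‖ₑ 1 with h | h
          · exact h.trans le_self_add
          · refine le_trans ?_ le_add_self
            calc ‖f t / r‖ₑ = ‖f t / r‖ₑ ^ (1 : ℝ) := (ENNReal.rpow_one _).symm
              _ ≤ ‖f t / r‖ₑ ^ p t := ENNReal.rpow_le_rpow_of_exponent_le h (p.one_le t)
      _ = μ univ + modular p μ (fun t => f t / r) := by
          rw [lintegral_add_left measurable_const]
          simp [modular]
      _ ≤ μ univ + 1 := by gcongr; exact hr.2
  have e : ∀ t, ‖f t‖ₑ = ENNReal.ofReal r * ‖f t / r‖ₑ := by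
    intro t
    rw [← Real.enorm_of_nonneg h0.le, ← enorm_mul]
    congr 1
    field_simp
  simp_rw [e]
  rw [lintegral_const_mul' _ _ ENNReal.ofReal_ne_top, mul_comm (μ.real univ + 1) r,
    ENNReal.ofReal_mul h0.le, ENNReal.ofReal_add measureReal_nonneg zero_le_one,
    ofReal_measureReal, ENNReal.ofReal_one]
  gcongr

lemma mem_L1 (f : VarLp p μ) : f.1 ∈ Lp ℝ 1 μ := by
  obtain ⟨r, hr⟩ := nonempty f
  rw [Lp.mem_Lp_iff_eLpNorm_lt_top, eLpNorm_one_eq_lintegral_enorm]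
  exact (lintegral_le_of_admissible _ hr).trans_lt ENNReal.ofReal_lt_top

/-- The inclusion `L^{p(·)}(μ) ↪ L¹(μ)`, `f ↦ f`, for a finite measure `μ`. -/
def inclusionL1 (p : Exponent Ω) (μ : Measure Ω) [IsFiniteMeasure μ] :
    VarLp p μ →L[ℝ] Lp ℝ 1 μ :=
  LinearMap.mkContinuous
    { toFun := fun f => ⟨f.1, mem_L1 f⟩
      map_add' := fun _ _ => rfl
      map_smul' := fun _ _ => rfl }
    (μ.real univ + 1) (by
      intro f
      have hM : 0 < μ.real univ + 1 := by positivity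
      rw [← div_le_iff₀' hM]
      apply le_csInf (nonempty f)
      intro r hr
      have h0 := hr.1
      rw [div_le_iff₀' hM, LinearMap.coe_mk, AddHom.coe_mk, Lp.norm_def,
        eLpNorm_one_eq_lintegral_enorm]
      exact ENNReal.toReal_le_of_le_ofReal (by positivity) (lintegral_le_of_admissible f.1 hr))

end Inclusion

end VarLp

/-- A bounded operator is *weakly compact* if it maps the closed unit ball to a relatively weakly
compact set. -/
def IsWeaklyCompactOperator {E F : Type*} [NormedAddCommGroup E] [NormedSpace ℝ E]
    [NormedAddCommGroup F] [NormedSpace ℝ F] (T : E →L[ℝ] F) : Prop :=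
  IsCompact (closure (toWeakSpace ℝ F '' (T '' Metric.closedBall (0 : E) 1)))

/-- The restriction of `T` to the subspace `S` is an isomorphism onto its image. -/
def IsIsomorphismOn {E F : Type*} [NormedAddCommGroup E] [NormedSpace ℝ E]
    [NormedAddCommGroup F] [NormedSpace ℝ F] (T : E →L[ℝ] F) (S : Submodule ℝ E) : Prop :=
  ∃ c : ℝ, 0 < c ∧ ∀ f ∈ S, c * ‖f‖ ≤ ‖T f‖

/-- An operator on `L^{p(·)}(μ)` is *disjointly strictly singular* if its restriction to the closed
linear span of any normalized pairwise disjoint sequence is not an isomorphism. -/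
def IsDisjointlyStrictlySingular {Ω : Type*} [MeasurableSpace Ω] {p : Exponent Ω} {μ : Measure Ω}
    {F : Type*} [NormedAddCommGroup F] [NormedSpace ℝ F] (T : VarLp p μ →L[ℝ] F) : Prop :=
  ∀ f : ℕ → VarLp p μ, (∀ n, ‖f n‖ = 1) →
    (∀ m n, m ≠ n → ∀ᵐ t ∂μ, (f m).1 t = 0 ∨ (f n).1 t = 0) →
    ¬ IsIsomorphismOn T (Submodule.span ℝ (range f)).topologicalClosure

/-- The decreasing rearrangement `f^*(x) = inf {s ≥ 0 : μ{f > s} ≤ x}`, for `0 ≤ x < μ(Ω)`, of a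
function `f` with values in `[0, ∞]`. -/
def decreasingRearrangement {Ω : Type*} [MeasurableSpace Ω] (μ : Measure Ω) (f : Ω → ℝ≥0∞)
    (x : ℝ) : ℝ≥0∞ :=
  sInf {s : ℝ≥0∞ | μ {t | s < f t} ≤ ENNReal.ofReal x}

/-- The power `a ^ e` for `a > 1` and `e ∈ [0, ∞]`, with `a ^ ∞ = ∞`. -/
def extPow (a : ℝ) (e : ℝ≥0∞) : ℝ≥0∞ :=
  if e = ∞ then ∞ else ENNReal.ofReal (a ^ e.toReal)

/-- The function `p / (p - 1)`, equal to `∞` where `p = 1`. -/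
def Exponent.conj {Ω : Type*} [MeasurableSpace Ω] (p : Exponent Ω) (t : Ω) : ℝ≥0∞ :=
  ENNReal.ofReal (p t) / ENNReal.ofReal (p t - 1)

/-- The function `(p - 1) / p`, with values in `[0, 1)`. -/
def Exponent.conjInv {Ω : Type*} [MeasurableSpace Ω] (p : Exponent Ω) (t : Ω) : ℝ≥0∞ :=
  ENNReal.ofReal ((p t - 1) / p t)

end

/-! All four statements are compared with one tail condition, `HasExpTails`: the measure of {p/(p-1)
≥ s} is O(a^(-s)) for every a > 1. The set is written s(p-1) ≤ p so that points with p = 1 belong to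
every tail. For statements 1 and 4 this is a computation with level sets of rearrangements.

Given the tails, put h_l = l^(-1/(p-1)). Where |f/2| > h_l one has |f/2| ≤ l|f/2|^p, so this part of
any f in the unit ball has L¹ norm at most 2l; the remaining part is dominated by 2h_l, which the
tails put in L². Hence the unit ball lies within 2l of a ball of L², which is weakly compact in L¹,
and Grothendieck's criterion gives weak compactness. Along a disjoint sequence the integrals of 2h_l
over the supports tend to 0, so the L¹ norms become small and the inclusion is DSS.

If the tails fail, `exists_disjoint_sequence` produces disjoint multiples of indicators that are
bounded in L^{p(·)} and have constant positive integral. Their mass escapes to sets decreasing to ∅,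
which excludes weak compactness; their span is a copy of ℓ¹ in both norms, which excludes DSS. -/

/-- The sets `{p / (p - 1) ≥ s}` have measure decaying faster than any exponential in `s`. -/
def HasExpTails {Ω : Type*} [MeasurableSpace Ω] (p : Exponent Ω) (μ : Measure Ω) : Prop :=
  ∀ a : ℝ, 1 < a → ∃ C : ℝ, 0 < C ∧
    ∀ s : ℝ, 0 < s → μ.real {t | s * (p t - 1) ≤ p t} ≤ C * a ^ (-s)

/-! ### Statements 1 and 4 in terms of the tails of p/(p-1) -/

section Rearrangement

variable {Ω : Type*} [MeasurableSpace Ω] {μ : Measure Ω}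

lemma decreasingRearrangement_le {f : Ω → ℝ≥0∞} {x : ℝ} {s : ℝ≥0∞}
    (h : μ {t | s < f t} ≤ ENNReal.ofReal x) : decreasingRearrangement μ f x ≤ s :=
  sInf_le h

lemma le_decreasingRearrangement {f : Ω → ℝ≥0∞} {x : ℝ} {s : ℝ≥0∞}
    (h : ENNReal.ofReal x < μ {t | s ≤ f t}) : s ≤ decreasingRearrangement μ f x := by
  refine le_sInf fun s' hs' => ?_
  by_contra! hlt
  exact absurd h (not_lt.2 ((measure_mono fun t (ht : s ≤ f t) => hlt.trans_le ht).trans hs'))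

lemma le_extPow {a s : ℝ} (ha : 1 < a) {e : ℝ≥0∞} (h : ENNReal.ofReal s ≤ e) :
    ENNReal.ofReal (a ^ s) ≤ extPow a e := by
  unfold extPow
  split_ifs with he
  · exact le_top
  · refine ENNReal.ofReal_le_ofReal (Real.rpow_le_rpow_of_exponent_le ha.le ?_)
    exact (ENNReal.ofReal_le_iff_le_toReal he).1 h

lemma extPow_le {a s : ℝ} (ha : 1 < a) (hs : 0 ≤ s) {e : ℝ≥0∞} (h : e ≤ ENNReal.ofReal s) :
    extPow a e ≤ ENNReal.ofReal (a ^ s) := by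
  have he : e ≠ ∞ := (h.trans_lt ENNReal.ofReal_lt_top).ne
  unfold extPow
  rw [if_neg he]
  refine ENNReal.ofReal_le_ofReal (Real.rpow_le_rpow_of_exponent_le ha.le ?_)
  exact ENNReal.toReal_le_of_le_ofReal hs h

namespace Exponent

variable (p : Exponent Ω)

lemma conj_eq_top {t : Ω} (h : p t = 1) : p.conj t = ∞ := by
  simp [conj, h]

lemma conj_eq_ofReal {t : Ω} (h : 1 < p t) : p.conj t = ENNReal.ofReal (p t / (p t - 1)) := by
  rw [conj, ENNReal.ofReal_div_of_pos (by linarith)]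

lemma le_conj_iff {s : ℝ} (t : Ω) :
    ENNReal.ofReal s ≤ p.conj t ↔ s * (p t - 1) ≤ p t := by
  rcases (p.one_le t).eq_or_lt with h | h
  · simp [p.conj_eq_top h.symm, ← h]
  · have h1 : 0 < p t - 1 := by linarith
    rw [p.conj_eq_ofReal h, ENNReal.ofReal_le_ofReal_iff (by positivity), le_div_iff₀ h1]

lemma conjInv_le_iff {s : ℝ} (hs : 0 < s) (t : Ω) :
    p.conjInv t ≤ ENNReal.ofReal s⁻¹ ↔ s * (p t - 1) ≤ p t := by
  have h0 : 0 < p t := zero_lt_one.trans_le (p.one_le t)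
  rw [conjInv, ENNReal.ofReal_le_ofReal_iff (by positivity), div_le_iff₀ h0, inv_mul_eq_div,
    le_div_iff₀ hs, mul_comm]

lemma measurableSet_tail (s : ℝ) : MeasurableSet {t | s * (p t - 1) ≤ p t} :=
  measurableSet_le ((p.measurable.sub_const 1).const_mul s) p.measurable

lemma tail_anti {s s' : ℝ} (h : s ≤ s') :
    {t | s' * (p t - 1) ≤ p t} ⊆ {t | s * (p t - 1) ≤ p t} := fun t ht => by
  have := p.one_le t
  have h2 : s * (p t - 1) ≤ s' * (p t - 1) := by gcongr
  exact h2.trans ht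

end Exponent

variable [IsFiniteMeasure μ] {p : Exponent Ω}

/-- Chebyshev's inequality: if the tail at s has measure d, the rearrangement is at least s on (0,
d), so a^s d is at most the integral. -/
lemma hasExpTails_of_integral_rearrangement (h : ∀ a : ℝ, 1 < a →
    ∫⁻ x in Ioo 0 (μ.real univ), extPow a (decreasingRearrangement μ p.conj x) < ∞) :
    HasExpTails p μ := by
  intro a ha
  set I := ∫⁻ x in Ioo 0 (μ.real univ), extPow a (decreasingRearrangement μ p.conj x) with hI
  refine ⟨I.toReal + 1, by positivity, fun s hs => ?_⟩
  set d := μ.real {t | s * (p t - 1) ≤ p t} with hd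
  have hset : {t | s * (p t - 1) ≤ p t} = {t | ENNReal.ofReal s ≤ p.conj t} := by
    ext t; exact (p.le_conj_iff t).symm
  have h1 : ENNReal.ofReal (a ^ s) * ENNReal.ofReal d ≤ I := by
    calc ENNReal.ofReal (a ^ s) * ENNReal.ofReal d
        = ∫⁻ x in Ioo 0 d, ENNReal.ofReal (a ^ s) := by simp
      _ ≤ ∫⁻ x in Ioo 0 d, extPow a (decreasingRearrangement μ p.conj x) := by
          refine setLIntegral_mono' measurableSet_Ioo fun x hx => le_extPow ha ?_
          refine le_decreasingRearrangement ?_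
          rw [← hset, ← ofReal_measureReal, ENNReal.ofReal_lt_ofReal_iff_of_nonneg hx.1.le]
          exact hx.2
      _ ≤ I := lintegral_mono_set (Ioo_subset_Ioo_right (measureReal_mono (subset_univ _)))
  have ha0 : 0 < a := by linarith
  have h2 : a ^ s * d ≤ I.toReal := by
    rw [← ENNReal.ofReal_mul (by positivity)] at h1
    exact (ENNReal.ofReal_le_iff_le_toReal (h a ha).ne).1 h1
  rw [Real.rpow_neg ha0.le, ← div_eq_mul_inv, le_div_iff₀ (by positivity)]
  linarith

/-- Decay with base a² bounds the integrand by a constant times x^(-1/2), which is integrable at 0.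
-/
lemma HasExpTails.integral_rearrangement (h : HasExpTails p μ) {a : ℝ} (ha : 1 < a) :
    ∫⁻ x in Ioo 0 (μ.real univ), extPow a (decreasingRearrangement μ p.conj x) < ∞ := by
  obtain ⟨C, hC, hCs⟩ := h (a ^ 2) (by nlinarith)
  have ha0 : 0 < a := by linarith
  have hlog : 0 < Real.log a := Real.log_pos ha
  set M := μ.real univ with hM
  have hM0 : 0 ≤ M := measureReal_nonneg
  have hint : IntegrableOn (fun x : ℝ => (C + M) ^ (2⁻¹ : ℝ) * x ^ (-(2⁻¹) : ℝ)) (Ioo 0 M) := by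
    have := intervalIntegral.intervalIntegrable_rpow' (a := 0) (b := M) (r := -(2⁻¹))
      (by norm_num)
    rw [intervalIntegrable_iff_integrableOn_Ioo_of_le hM0] at this
    exact this.const_mul _
  refine lt_of_le_of_lt (setLIntegral_mono' measurableSet_Ioo fun x hx => ?_)
    hint.lintegral_lt_top
  have hx0 := hx.1
  have hCM : 1 < (C + M) / x := by rw [one_lt_div hx0]; linarith [hx.2]
  -- This s solves (a²)^(-s) = x/(C+M), so the tail at s has measure at most x. Adding M to C makes
  -- the quotient exceed 1, hence s > 0.
  set s := Real.log ((C + M) / x) / (2 * Real.log a) with hs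
  have hs0 : 0 < s := div_pos (Real.log_pos hCM) (by positivity)
  have e1 : a ^ s = (C + M) ^ (2⁻¹ : ℝ) * x ^ (-(2⁻¹) : ℝ) := by
    rw [Real.rpow_neg hx0.le, ← div_eq_mul_inv, ← Real.div_rpow (by positivity) hx0.le,
      Real.rpow_def_of_pos ha0, Real.rpow_def_of_pos (by positivity)]
    congr 1
    rw [hs]
    field_simp
  have e2 : (a ^ 2) ^ (-s) = x / (C + M) := by
    rw [Real.rpow_def_of_pos (by positivity), Real.log_pow, hs,
      ← Real.exp_log (show 0 < x / (C + M) by positivity), ← inv_div (C + M) x, Real.log_inv]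
    congr 1
    push_cast
    field_simp
  rw [← e1]
  refine extPow_le ha hs0.le (decreasingRearrangement_le ?_)
  have h2 := hCs s hs0
  rw [e2] at h2
  have h3 : C * (x / (C + M)) ≤ x := by
    rw [mul_div_assoc', div_le_iff₀ (by positivity)]
    nlinarith
  calc μ {t | ENNReal.ofReal s < p.conj t} ≤ μ {t | s * (p t - 1) ≤ p t} :=
        measure_mono fun t ht => (p.le_conj_iff t).1 (le_of_lt ht)
    _ = ENNReal.ofReal (μ.real {t | s * (p t - 1) ≤ p t}) := (ofReal_measureReal).symm
    _ ≤ ENNReal.ofReal x := ENNReal.ofReal_le_ofReal (h2.trans h3)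

lemma measureReal_conjInv_gt {s : ℝ} (hs : 0 < s) :
    μ.real {t | ENNReal.ofReal s⁻¹ < p.conjInv t} =
      μ.real univ - μ.real {t | s * (p t - 1) ≤ p t} := by
  rw [← measureReal_compl (p.measurableSet_tail s)]
  congr 1
  ext t
  simp only [mem_compl_iff, mem_ofPred_eq, ← p.conjInv_le_iff hs, not_le]

/-- For y at most the tail measure d at s, the rearrangement of (p-1)/p at M - y is at most 1/s. The
limit then gives y^(1/s) < 1/a for small y, that is y < a^(-s). -/
lemma hasExpTails_of_tendsto (h : Tendsto
    (fun x : ℝ => (μ.real univ - x) ^ (decreasingRearrangement μ p.conjInv x).toReal)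
    (𝓝[Ico 0 (μ.real univ)] (μ.real univ)) (𝓝 0)) : HasExpTails p μ := by
  intro a ha
  have ha0 : 0 < a := by linarith
  set M := μ.real univ with hM
  have hM0 : 0 ≤ M := measureReal_nonneg
  have h1 := h.eventually (gt_mem_nhds (inv_pos.2 ha0))
  rw [eventually_nhdsWithin_iff, Metric.eventually_nhds_iff] at h1
  obtain ⟨δ, hδ, h1⟩ := h1
  -- The limit controls only small y, so d is truncated at η. If d ≥ η, the argument yields η ≤
  -- a^(-s), and the factor M/η in the constant covers d ≤ M.
  set η := min (δ / 2) 1 with hη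
  have hη0 : 0 < η := lt_min (by positivity) one_pos
  refine ⟨max 1 (M / η), by positivity, fun s hs => ?_⟩
  set d := μ.real {t | s * (p t - 1) ≤ p t} with hd
  have hd0 : 0 ≤ d := measureReal_nonneg
  have hdM : d ≤ M := measureReal_mono (subset_univ _)
  have hpos : 0 < a ^ (-s) := by positivity
  rcases hd0.eq_or_lt with hd' | hd'
  · rw [← hd']; positivity
  set y := min η d with hy
  have hy0 : 0 < y := lt_min hη0 hd'
  have hyd : y ≤ d := min_le_right _ _
  have hyη : y ≤ η := min_le_left _ _
  have hy1 : y ≤ 1 := hyη.trans (min_le_right _ _)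
  have hyδ : y ≤ δ / 2 := hyη.trans (min_le_left _ _)
  have key : y ≤ a ^ (-s) := by
    have h2 := h1 (y := M - y) (by
      rw [Real.dist_eq, sub_sub_cancel_left, abs_neg, abs_of_pos hy0]; linarith)
      ⟨by linarith, by linarith⟩
    rw [sub_sub_cancel] at h2
    have h3 : decreasingRearrangement μ p.conjInv (M - y) ≤ ENNReal.ofReal s⁻¹ := by
      apply decreasingRearrangement_le
      rw [← ofReal_measureReal, measureReal_conjInv_gt hs]
      exact ENNReal.ofReal_le_ofReal (by linarith)
    have h4 : y ^ s⁻¹ < a⁻¹ := lt_of_le_of_lt (Real.rpow_le_rpow_of_exponent_ge hy0 hy1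
      (ENNReal.toReal_le_of_le_ofReal (by positivity) h3)) h2
    calc y = (y ^ s⁻¹) ^ s := by rw [Real.rpow_inv_rpow hy0.le hs.ne']
      _ ≤ (a⁻¹) ^ s := Real.rpow_le_rpow (by positivity) h4.le hs.le
      _ = a ^ (-s) := by rw [Real.inv_rpow ha0.le, Real.rpow_neg ha0.le]
  rcases le_total d η with hc | hc
  · rw [hy, min_eq_right hc] at key
    calc d ≤ 1 * a ^ (-s) := by linarith
      _ ≤ _ := by gcongr; exact le_max_left _ _
  · rw [hy, min_eq_left hc] at key
    calc d ≤ M := hdM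
      _ = M / η * η := by field_simp
      _ ≤ M / η * a ^ (-s) := by gcongr
      _ ≤ _ := by gcongr; exact le_max_right _ _

lemma HasExpTails.tendsto (h : HasExpTails p μ) : Tendsto
    (fun x : ℝ => (μ.real univ - x) ^ (decreasingRearrangement μ p.conjInv x).toReal)
    (𝓝[Ico 0 (μ.real univ)] (μ.real univ)) (𝓝 0) := by
  set M := μ.real univ with hM
  rw [Metric.tendsto_nhdsWithin_nhds]
  intro ε hε
  set b := min (ε / 2) 2⁻¹ with hb
  have hb0 : 0 < b := lt_min (by positivity) (by norm_num)
  have hb1 : b < 1 := (min_le_right _ _).trans_lt (by norm_num)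
  have hbε : b < ε := (min_le_left _ _).trans_lt (by linarith)
  obtain ⟨C, hC, hCs⟩ := h (b⁻¹ ^ 2) (one_lt_pow₀ ((one_lt_inv₀ hb0).2 hb1) (by norm_num))
  refine ⟨min 2⁻¹ (C⁻¹ / 2), by positivity, fun {x} hx hxd => ?_⟩
  rw [Real.dist_eq, abs_sub_comm] at hxd
  set y := M - x with hy
  have hy0 : 0 < y := sub_pos.2 hx.2
  rw [abs_of_pos hy0] at hxd
  have hy1 : y < 1 := (hxd.trans_le (min_le_left _ _)).trans (by norm_num)
  have hyC : y < C⁻¹ / 2 := hxd.trans_le (min_le_right _ _)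
  have hlb : Real.log b < 0 := Real.log_neg hb0 hb1
  have hly : Real.log y < 0 := Real.log_neg hy0 hy1
  set R := decreasingRearrangement μ p.conjInv x with hR
  -- Chosen so that y^(1/s) = b. With base b^(-2) the tail at s is at most C y², which is strictly
  -- below y once y is small; the strictness forces the rearrangement at x up to 1/s.
  set s := Real.log y / Real.log b with hs
  have hs0 : 0 < s := div_pos_of_neg_of_neg hly hlb
  have e1 : y ^ s⁻¹ = b := by
    rw [Real.rpow_def_of_pos hy0, hs, inv_div, mul_div_cancel₀ _ hly.ne, Real.exp_log hb0]
  have e2 : (b⁻¹ ^ 2) ^ (-s) = y ^ 2 := by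
    rw [Real.rpow_def_of_pos (by positivity), Real.log_pow, Real.log_inv, hs]
    conv_rhs => rw [← Real.exp_log hy0, ← Real.exp_nat_mul]
    congr 1
    push_cast
    have := hlb.ne
    field_simp
  have h2 := hCs s hs0
  rw [e2] at h2
  have h3 : C * y ^ 2 < y := by
    have : C * y < 1 := by
      calc C * y < C * (C⁻¹ / 2) := by gcongr
        _ < 1 := by field_simp; norm_num
    nlinarith
  have hRs : ENNReal.ofReal s⁻¹ ≤ R := by
    refine le_decreasingRearrangement ?_
    calc ENNReal.ofReal x
        < ENNReal.ofReal (M - μ.real {t | s * (p t - 1) ≤ p t}) := by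
          rw [ENNReal.ofReal_lt_ofReal_iff_of_nonneg hx.1]
          linarith
      _ = μ {t | ENNReal.ofReal s⁻¹ < p.conjInv t} := by
          rw [← measureReal_conjInv_gt hs0, ofReal_measureReal]
      _ ≤ μ {t | ENNReal.ofReal s⁻¹ ≤ p.conjInv t} := by
          refine measure_mono fun t ht => ?_
          simp only [mem_ofPred_eq] at ht ⊢
          exact ht.le
  -- Needed because `toReal` sends ∞ to 0, which would destroy the lower bound on the exponent.
  have hRtop : R ≠ ∞ := by
    refine ne_top_of_le_ne_top ENNReal.one_ne_top (decreasingRearrangement_le ?_)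
    have : {t | 1 < p.conjInv t} = ∅ := by
      ext t
      have h0 : 0 < p t := zero_lt_one.trans_le (p.one_le t)
      simp only [mem_ofPred_eq, mem_empty_iff_false, iff_false, not_lt, Exponent.conjInv]
      rw [ENNReal.ofReal_le_one, div_le_one h0]
      linarith
    rw [this]; simp
  have h5 : s⁻¹ ≤ R.toReal := (ENNReal.ofReal_le_iff_le_toReal hRtop).1 hRs
  rw [dist_zero_right, Real.norm_of_nonneg (by positivity)]
  calc y ^ R.toReal ≤ y ^ s⁻¹ := Real.rpow_le_rpow_of_exponent_ge hy0 hy1.le h5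
    _ = b := e1
    _ < ε := hbε

end Rearrangement

/-! ### Weak compactness: Hilbert balls and Grothendieck's criterion -/

section WeakCompactness

open scoped Pointwise

/-- Through the Riesz isomorphism the ball is a dual ball, weak-* compact by Banach–Alaoglu, and T
is weak-*-to-weak continuous on it. -/
lemma isCompact_toWeakSpace_image_closedBall_of_hilbert {H F : Type*} [NormedAddCommGroup H]
    [InnerProductSpace ℝ H] [CompleteSpace H] [NormedAddCommGroup F] [NormedSpace ℝ F]
    (T : H →L[ℝ] F) (R : ℝ) :
    IsCompact (toWeakSpace ℝ F '' (T '' Metric.closedBall (0 : H) R)) := by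
  set D := InnerProductSpace.toDual ℝ H
  let Ψ : WeakDual ℝ H → WeakSpace ℝ F := fun φ =>
    toWeakSpace ℝ F (T (D.symm (WeakDual.toStrongDual φ)))
  have hΨ : Continuous Ψ := by
    refine WeakBilin.continuous_of_continuous_eval _ fun l => ?_
    have e : ∀ φ : WeakDual ℝ H, (topDualPairing ℝ F).flip (Ψ φ) l =
        φ (D.symm (l ∘L T)) := by
      intro φ
      have h1 : (l ∘L T) (D.symm (WeakDual.toStrongDual φ)) =
          inner ℝ (D.symm (l ∘L T)) (D.symm (WeakDual.toStrongDual φ)) := by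
        rw [InnerProductSpace.toDual_symm_apply]
      have h2 : φ (D.symm (l ∘L T)) =
          inner ℝ (D.symm (WeakDual.toStrongDual φ)) (D.symm (l ∘L T)) := by
        rw [InnerProductSpace.toDual_symm_apply]; rfl
      rw [h2, real_inner_comm, ← h1]
      rfl
    exact (continuous_congr e).2 (WeakDual.eval_continuous _)
  have := (WeakDual.isCompact_closedBall (𝕜 := ℝ) (E := H) 0 R).image hΨ
  convert this using 1
  ext y
  simp only [mem_image, mem_preimage, mem_closedBall_zero_iff]
  constructor
  · rintro ⟨_, ⟨x, hx, rfl⟩, rfl⟩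
    refine ⟨StrongDual.toWeakDual (D x), by simpa using hx, by simp [Ψ]⟩
  · rintro ⟨φ, hφ, rfl⟩
    exact ⟨_, ⟨D.symm (WeakDual.toStrongDual φ), by simpa using hφ, rfl⟩, rfl⟩

/-- Grothendieck's criterion: a set which is approximated uniformly in norm by weakly compact sets
is relatively weakly compact. -/
lemma isCompact_closure_toWeakSpace_image {F : Type*} [NormedAddCommGroup F] [NormedSpace ℝ F]
    [CompleteSpace F] {K : Set F} (hK : Bornology.IsBounded K)
    (h : ∀ ε : ℝ, 0 < ε → ∃ W : Set F, IsCompact (toWeakSpace ℝ F '' W) ∧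
      ∀ x ∈ K, ∃ w ∈ W, ‖x - w‖ ≤ ε) :
    IsCompact (closure (toWeakSpace ℝ F '' K)) := by
  set J := NormedSpace.inclusionInDoubleDualWeak ℝ F
  set j := NormedSpace.inclusionInDoubleDualLi ℝ (E := F)
  have hJ : ∀ x : F, J (toWeakSpace ℝ F x) = StrongDual.toWeakDual (j x) := fun x => rfl
  -- It remains to show that the weak-* closure of K in the bidual stays inside F. As F is norm
  -- closed there, being within every ε of F suffices.
  refine NormedSpace.isCompact_closure_of_isBounded ℝ F _ (by
    rwa [preimage_image_eq _ (toWeakSpace ℝ F).injective]) ?_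
  intro y hy
  have hclosed : IsClosed (range j) := by
    have hj : Isometry j := j.isometry
    exact hj.isClosedEmbedding.isClosed_range
  suffices hmem : WeakDual.toStrongDual y ∈ closure (range j) by
    rw [hclosed.closure_eq] at hmem
    obtain ⟨x, hx⟩ := hmem
    refine ⟨toWeakSpace ℝ F x, ?_⟩
    rw [hJ, hx]; rfl
  refine (Metric.mem_closure_iff (α := StrongDual ℝ (StrongDual ℝ F))).2 fun ε hε => ?_
  obtain ⟨W, hW, hKW⟩ := h (ε / 2) (half_pos hε)
  have hball : ∀ z : StrongDual ℝ (StrongDual ℝ F),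
      z ∈ Metric.closedBall (0 : StrongDual ℝ (StrongDual ℝ F)) (ε / 2) ↔ ‖z‖ ≤ ε / 2 :=
    fun _ => mem_closedBall_zero_iff (E := StrongDual ℝ (StrongDual ℝ F))
  -- A sum of weak-* compact sets is weak-* compact, hence closed, so it contains the weak-* closure
  -- of K along with K.
  have hcomp : IsCompact (J '' (toWeakSpace ℝ F '' W) +
      (WeakDual.toStrongDual ⁻¹' Metric.closedBall 0 (ε / 2) :
        Set (WeakDual ℝ (StrongDual ℝ F)))) :=
    (hW.image J.continuous).add (WeakDual.isCompact_closedBall 0 (ε / 2))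
  have hsub : J '' (toWeakSpace ℝ F '' K) ⊆ J '' (toWeakSpace ℝ F '' W) +
      (WeakDual.toStrongDual ⁻¹' Metric.closedBall 0 (ε / 2) :
        Set (WeakDual ℝ (StrongDual ℝ F))) := by
    rintro _ ⟨_, ⟨x, hx, rfl⟩, rfl⟩
    obtain ⟨w, hw, hxw⟩ := hKW x hx
    refine Set.mem_add.2 ⟨_, ⟨_, ⟨w, hw, rfl⟩, rfl⟩, J (toWeakSpace ℝ F (x - w)), ?_, ?_⟩
    · rw [mem_preimage, hJ]
      exact (hball _).2 ((j.norm_map (x - w)).trans_le hxw)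
    · rw [← map_add, ← map_add, add_sub_cancel]
  obtain ⟨_, ⟨_, ⟨w, hw, rfl⟩, rfl⟩, z, hz, rfl⟩ :=
    Set.mem_add.1 (closure_minimal hsub hcomp.isClosed hy)
  refine ⟨j w, ⟨w, rfl⟩, ?_⟩
  rw [mem_preimage] at hz
  replace hz := (hball _).1 hz
  have hd : dist (WeakDual.toStrongDual (J (toWeakSpace ℝ F w) + z)) (j w) =
      ‖WeakDual.toStrongDual z‖ :=
    (dist_eq_norm (E := StrongDual ℝ (StrongDual ℝ F)) _ _).trans
      (congrArg _ (add_sub_cancel_left (j w) (WeakDual.toStrongDual z)))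
  rw [hd]
  linarith

end WeakCompactness

/-! ### Exponential tails imply weak compactness and DSS -/

section Tails

open VarLebesgue

variable {Ω : Type*} [MeasurableSpace Ω] {μ : Measure Ω} {p : Exponent Ω}

lemma VarLp.modular_div_le_one {f : VarLp p μ} {r : ℝ} (h : ‖f‖ < r) :
    modular p μ (fun t => f.1 t / r) ≤ 1 := by
  obtain ⟨s, hs, hsr⟩ := exists_lt_of_csInf_lt (VarLp.nonempty f) h
  exact (modular_div_anti hs.1 hsr.le).trans hs.2

variable [IsFiniteMeasure μ]

/-- The set {p = 1} lies in every tail, and the tails shrink to measure 0. -/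
lemma HasExpTails.ae_one_lt (h : HasExpTails p μ) : ∀ᵐ t ∂μ, 1 < p t := by
  obtain ⟨C, hC, hCs⟩ := h 2 one_lt_two
  have hle : ∀ n : ℕ, μ.real {t | p t = 1} ≤ C * (2⁻¹ : ℝ) ^ (n + 1) := by
    intro n
    have hs : (0 : ℝ) < (n + 1 : ℕ) := by positivity
    have h1 := hCs (n + 1 : ℕ) hs
    rw [Real.rpow_neg zero_le_two, Real.rpow_natCast, ← inv_pow] at h1
    refine (measureReal_mono fun t ht => ?_).trans h1
    simp only [mem_ofPred_eq] at ht ⊢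
    simp [ht]
  have hlim : Tendsto (fun n : ℕ => C * (2⁻¹ : ℝ) ^ (n + 1)) atTop (𝓝 (C * 0)) :=
    ((tendsto_pow_atTop_nhds_zero_of_lt_one (by norm_num) (by norm_num)).comp
      (tendsto_add_atTop_nat 1)).const_mul C
  rw [mul_zero] at hlim
  have h0 : μ.real {t | p t = 1} = 0 := le_antisymm (ge_of_tendsto' hlim hle) measureReal_nonneg
  rw [measureReal_eq_zero_iff] at h0
  have := measure_eq_zero_iff_ae_notMem.1 h0
  filter_upwards [this] with t ht
  exact lt_of_le_of_ne (p.one_le t) (Ne.symm ht)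

/-- Layer-cake over integer levels: the tail at n has measure O(a^(-2n)) while the integrand is at
most a^(n+1) on the layer, leaving a geometric series. -/
lemma HasExpTails.lintegral_lt_top (h : HasExpTails p μ) {a : ℝ} (ha : 1 < a) :
    ∫⁻ t, ENNReal.ofReal (a ^ (p t - 1)⁻¹) ∂μ < ∞ := by
  obtain ⟨C, hC, hCs⟩ := h (a ^ 2) (by nlinarith)
  have ha0 : 0 < a := by linarith
  set M := μ.real univ
  have hM0 : 0 ≤ M := measureReal_nonneg
  set E : ℕ → Set Ω := fun n => {t | (n : ℝ) * (p t - 1) ≤ p t}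
  have hE : ∀ n, μ (E n) ≤ ENNReal.ofReal ((C + M) * (a ^ 2)⁻¹ ^ n) := by
    intro n
    rw [← ofReal_measureReal]
    apply ENNReal.ofReal_le_ofReal
    rcases n.eq_zero_or_pos with rfl | hn
    · have : μ.real (E 0) ≤ M := measureReal_mono (subset_univ _)
      simp only [pow_zero, mul_one]
      linarith
    · have h1 := hCs n (by exact_mod_cast hn)
      rw [Real.rpow_neg (by positivity), Real.rpow_natCast, ← inv_pow] at h1
      refine h1.trans ?_
      gcongr
      linarith
  have hpt : ∀ t, ENNReal.ofReal (a ^ (p t - 1)⁻¹) ≤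
      ∑' n : ℕ, (E n).indicator (fun _ => ENNReal.ofReal (a ^ (n + 1))) t := by
    intro t
    -- Where p = 1 the convention 0⁻¹ = 0 gives n = 0, and the estimate below still holds.
    have hp1 : 0 ≤ p t - 1 := by linarith [p.one_le t]
    set n := ⌊(p t - 1)⁻¹⌋₊
    refine le_trans ?_ (ENNReal.le_tsum n)
    have hn : (n : ℝ) ≤ (p t - 1)⁻¹ := Nat.floor_le (by positivity)
    have hmem : t ∈ E n := by
      show (n : ℝ) * (p t - 1) ≤ p t
      calc (n : ℝ) * (p t - 1) ≤ (p t - 1)⁻¹ * (p t - 1) := by gcongr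
        _ ≤ 1 := inv_mul_le_one
        _ ≤ p t := p.one_le t
    rw [indicator_of_mem hmem]
    apply ENNReal.ofReal_le_ofReal
    rw [← Real.rpow_natCast]
    apply Real.rpow_le_rpow_of_exponent_le ha.le
    push_cast
    exact (Nat.lt_floor_add_one _).le
  have hsum : Summable fun n : ℕ => (C + M) * a * (a⁻¹) ^ n :=
    (summable_geometric_of_lt_one (by positivity) (inv_lt_one_of_one_lt₀ ha)).mul_left _
  calc ∫⁻ t, ENNReal.ofReal (a ^ (p t - 1)⁻¹) ∂μ
      ≤ ∫⁻ t, ∑' n : ℕ, (E n).indicator (fun _ => ENNReal.ofReal (a ^ (n + 1))) t ∂μ :=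
        lintegral_mono hpt
    _ = ∑' n : ℕ, ENNReal.ofReal (a ^ (n + 1)) * μ (E n) := by
        rw [lintegral_tsum fun n : ℕ =>
          (measurable_const.indicator (p.measurableSet_tail n)).aemeasurable]
        congr 1
        ext n
        rw [lintegral_indicator_const (p.measurableSet_tail n)]
    _ ≤ ∑' n : ℕ, ENNReal.ofReal ((C + M) * a * (a⁻¹) ^ n) := by
        refine ENNReal.tsum_le_tsum fun n => ?_
        calc ENNReal.ofReal (a ^ (n + 1)) * μ (E n)
            ≤ ENNReal.ofReal (a ^ (n + 1)) * ENNReal.ofReal ((C + M) * (a ^ 2)⁻¹ ^ n) := by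
              gcongr; exact hE n
          _ = _ := by
              rw [← ENNReal.ofReal_mul (by positivity)]
              congr 1
              rw [inv_pow, inv_pow]
              field_simp
              ring
    _ < ∞ := hsum.tsum_ofReal_lt_top

namespace Exponent

/-- The threshold `l ^ (-1 / (p - 1))` above which `x ≤ l * x ^ p`. -/
noncomputable def threshold (p : Exponent Ω) (l : ℝ) (t : Ω) : ℝ := (l⁻¹) ^ (p t - 1)⁻¹

lemma measurable_threshold (p : Exponent Ω) (l : ℝ) : Measurable (p.threshold l) :=
  (p.measurable.sub_const 1).inv.const_pow _

lemma threshold_nonneg (p : Exponent Ω) {l : ℝ} (hl : 0 < l) (t : Ω) : 0 ≤ p.threshold l t :=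
  Real.rpow_nonneg (inv_nonneg.2 hl.le) _

lemma le_mul_rpow_of_threshold_lt {l : ℝ} (hl : 0 < l) {t : Ω} (ht : 1 < p t) {x : ℝ}
    (hx : p.threshold l t < x) : x ≤ l * x ^ p t := by
  have hp : 0 < p t - 1 := by linarith
  have hx0 : 0 < x := (p.threshold_nonneg hl t).trans_lt hx
  have h1 : l⁻¹ ≤ x ^ (p t - 1) := by
    calc l⁻¹ = (p.threshold l t) ^ (p t - 1) :=
          (Real.rpow_inv_rpow (inv_nonneg.2 hl.le) hp.ne').symm
      _ ≤ x ^ (p t - 1) := Real.rpow_le_rpow (p.threshold_nonneg hl t) hx.le hp.le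
  have h2 : x ^ p t = x ^ (p t - 1) * x := by
    rw [← Real.rpow_add_one hx0.ne', sub_add_cancel]
  rw [h2, ← mul_assoc]
  have h3 : 1 ≤ l * x ^ (p t - 1) := by
    calc (1 : ℝ) = l * l⁻¹ := (mul_inv_cancel₀ hl.ne').symm
      _ ≤ _ := by gcongr
  nlinarith

lemma enorm_le_mul_rpow_of_threshold_lt {l : ℝ} (hl : 0 < l) {t : Ω} (ht : 1 < p t) {x : ℝ}
    (hx : p.threshold l t < |x|) : ‖x‖ₑ ≤ ENNReal.ofReal l * ‖x‖ₑ ^ p t := by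
  have h := le_mul_rpow_of_threshold_lt hl ht hx
  have hp : 0 ≤ p t := by linarith
  rw [← ofReal_norm, Real.norm_eq_abs, ENNReal.ofReal_rpow_of_nonneg (abs_nonneg x) hp,
    ← ENNReal.ofReal_mul hl.le]
  exact ENNReal.ofReal_le_ofReal h

end Exponent

/-- Squaring the threshold only replaces the base l⁻¹ by l⁻², and the tails handle every base. -/
lemma HasExpTails.memLp_threshold (h : HasExpTails p μ) {l : ℝ} (hl : 0 < l) (hl1 : l < 1) :
    MemLp (p.threshold l) 2 μ := by
  rw [memLp_two_iff_integrable_sq (p.measurable_threshold l).aestronglyMeasurable]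
  refine ⟨((p.measurable_threshold l).pow_const 2).aestronglyMeasurable, ?_⟩
  rw [hasFiniteIntegral_iff_ofReal (ae_of_all _ fun t => sq_nonneg _)]
  have := h.lintegral_lt_top (a := l⁻¹ ^ 2) (one_lt_pow₀ ((one_lt_inv₀ hl).2 hl1) (by norm_num))
  convert this using 4 with t
  have : (0 : ℝ) ≤ l⁻¹ := inv_nonneg.2 hl.le
  rw [Exponent.threshold, ← Real.rpow_natCast, ← Real.rpow_natCast, ← Real.rpow_mul this,
    ← Real.rpow_mul this, mul_comm]

lemma VarLp.enorm_inclusionL1 (f : VarLp p μ) :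
    ENNReal.ofReal ‖VarLp.inclusionL1 p μ f‖ = ∫⁻ t, ‖f.1 t‖ₑ ∂μ := by
  rw [ofReal_norm, Lp.enorm_def, eLpNorm_one_eq_lintegral_enorm]
  rfl

/-- Dividing by 2 makes the norm strictly less than the scaling, so the modular is at most 1 without
knowing that the Luxemburg infimum is attained. -/
lemma HasExpTails.lintegral_large_le (h : HasExpTails p μ) {l : ℝ} (hl : 0 < l) {f : VarLp p μ}
    (hf : ‖f‖ ≤ 1) :
    ∫⁻ t in {t | p.threshold l t < |f.1 t / 2|}, ‖f.1 t‖ₑ ∂μ ≤ ENNReal.ofReal (2 * l) := by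
  have e : ∀ t, ‖f.1 t‖ₑ = ENNReal.ofReal 2 * ‖f.1 t / 2‖ₑ := fun t => by
    rw [← Real.enorm_of_nonneg zero_le_two, ← enorm_mul]
    congr 1
    ring
  have hm : MeasurableSet {t | p.threshold l t < |f.1 t / 2|} :=
    measurableSet_lt (p.measurable_threshold l) (f.1.measurable.div_const 2).abs
  calc ∫⁻ t in {t | p.threshold l t < |f.1 t / 2|}, ‖f.1 t‖ₑ ∂μ
      ≤ ∫⁻ t in {t | p.threshold l t < |f.1 t / 2|},
          ENNReal.ofReal (2 * l) * ‖f.1 t / 2‖ₑ ^ p t ∂μ := by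
        refine lintegral_mono_ae ((ae_restrict_iff' hm).2 ?_)
        filter_upwards [h.ae_one_lt] with t ht htl
        rw [e, ENNReal.ofReal_mul zero_le_two, mul_assoc]
        gcongr
        exact Exponent.enorm_le_mul_rpow_of_threshold_lt hl ht htl
    _ ≤ ∫⁻ t, ENNReal.ofReal (2 * l) * ‖f.1 t / 2‖ₑ ^ p t ∂μ := setLIntegral_le_lintegral _ _
    _ = ENNReal.ofReal (2 * l) * modular p μ (fun t => f.1 t / 2) := by
        rw [lintegral_const_mul' _ _ ENNReal.ofReal_ne_top]
        rfl
    _ ≤ ENNReal.ofReal (2 * l) * 1 := by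
        gcongr
        exact VarLp.modular_div_le_one (hf.trans_lt one_lt_two)
    _ = _ := mul_one _

/-- The inclusion `L² ↪ L¹` of a finite measure space. -/
noncomputable def inclusionL2L1 (μ : Measure Ω) [IsFiniteMeasure μ] : Lp ℝ 2 μ →L[ℝ] Lp ℝ 1 μ :=
  LinearMap.mkContinuous
    { toFun := fun f => ⟨f.1, Lp.antitone one_le_two f.2⟩
      map_add' := fun _ _ => rfl
      map_smul' := fun _ _ => rfl }
    ((μ univ) ^ (1 / (1 : ℝ≥0∞).toReal - 1 / (2 : ℝ≥0∞).toReal)).toReal (by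
      intro f
      have h := eLpNorm_le_eLpNorm_mul_rpow_measure_univ (μ := μ) one_le_two
        (Lp.aestronglyMeasurable f)
      rw [mul_comm, LinearMap.coe_mk, AddHom.coe_mk, Lp.norm_def, Lp.norm_def, ← ENNReal.toReal_mul]
      refine ENNReal.toReal_mono (ENNReal.mul_ne_top (Lp.eLpNorm_ne_top f) ?_) h
      exact ENNReal.rpow_ne_top_of_nonneg (by norm_num) (measure_ne_top _ _))

theorem HasExpTails.isWeaklyCompactOperator (h : HasExpTails p μ) :
    IsWeaklyCompactOperator (VarLp.inclusionL1 p μ) := by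
  refine isCompact_closure_toWeakSpace_image
    ((VarLp.inclusionL1 p μ).lipschitz.isBounded_image Metric.isBounded_closedBall) fun ε hε => ?_
  set l := min (ε / 2) 2⁻¹
  have hl : 0 < l := lt_min (half_pos hε) (by norm_num)
  have hl1 : l < 1 := (min_le_right _ _).trans_lt (by norm_num)
  have hlε : 2 * l ≤ ε := by
    have : l ≤ ε / 2 := min_le_left _ _
    linarith
  set H : Ω → ℝ := fun t => 2 * p.threshold l t
  have hH : MemLp H 2 μ := (h.memLp_threshold hl hl1).const_mul 2
  refine ⟨inclusionL2L1 μ '' Metric.closedBall 0 (eLpNorm H 2 μ).toReal,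
    isCompact_toWeakSpace_image_closedBall_of_hilbert _ _, ?_⟩
  rintro _ ⟨f, hf, rfl⟩
  rw [mem_closedBall_zero_iff] at hf
  set S := {t | p.threshold l t < |f.1 t / 2|}
  have hS : MeasurableSet S :=
    measurableSet_lt (p.measurable_threshold l) (f.1.measurable.div_const 2).abs
  -- The part of f below twice the threshold: it lies in a fixed L² ball, and f - g has L¹ norm at
  -- most 2l ≤ ε.
  set g : Ω → ℝ := Sᶜ.indicator f.1
  have hgm : AEStronglyMeasurable g μ := f.1.aestronglyMeasurable.indicator hS.compl
  have hgH : ∀ᵐ t ∂μ, ‖g t‖ ≤ ‖H t‖ := by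
    refine ae_of_all _ fun t => ?_
    have h0 := p.threshold_nonneg hl t
    by_cases ht : t ∈ S
    · rw [show g t = 0 from indicator_of_notMem (by simpa using ht) _]
      simp
    · rw [show g t = f.1 t from indicator_of_mem (by simpa using ht) _]
      have h1 : |f.1 t / 2| ≤ p.threshold l t := not_lt.1 ht
      rw [abs_div, abs_two, div_le_iff₀ two_pos] at h1
      rw [Real.norm_eq_abs, Real.norm_of_nonneg (by positivity)]
      show _ ≤ 2 * _
      linarith
  have hg : MemLp g 2 μ := hH.mono hgm hgH
  refine ⟨_, ⟨hg.toLp g, ?_, rfl⟩, ?_⟩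
  · rw [mem_closedBall_zero_iff, Lp.norm_toLp]
    exact ENNReal.toReal_mono hH.eLpNorm_ne_top (eLpNorm_mono_ae hgH)
  · rw [Lp.norm_def, eLpNorm_one_eq_lintegral_enorm]
    refine ENNReal.toReal_le_of_le_ofReal hε.le ?_
    refine le_trans (le_of_eq ?_) ((h.lintegral_large_le hl hf).trans
      (ENNReal.ofReal_le_ofReal hlε))
    rw [← lintegral_indicator hS]
    refine lintegral_congr_ae ?_
    filter_upwards [Lp.coeFn_sub (VarLp.inclusionL1 p μ f) (inclusionL2L1 μ (hg.toLp g)),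
      hg.coeFn_toLp] with t h1 h2
    have h3 : (inclusionL2L1 μ (hg.toLp g)) t = g t := h2
    have h4 : (VarLp.inclusionL1 p μ f) t = f.1 t := rfl
    rw [h1, Pi.sub_apply, h3, h4]
    by_cases ht : t ∈ S
    · rw [show g t = 0 from indicator_of_notMem (by simpa using ht) _, indicator_of_mem ht,
        sub_zero]
    · rw [show g t = f.1 t from indicator_of_mem (by simpa using ht) _, indicator_of_notMem ht,
        sub_self, enorm_zero]

theorem HasExpTails.isDisjointlyStrictlySingular (h : HasExpTails p μ) :
    IsDisjointlyStrictlySingular (VarLp.inclusionL1 p μ) := by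
  rintro f hf hdisj ⟨c, hc, hiso⟩
  set l := min (c / 4) 2⁻¹
  have hl : 0 < l := lt_min (by positivity) (by norm_num)
  have hl1 : l < 1 := (min_le_right _ _).trans_lt (by norm_num)
  have hlc : 2 * l ≤ c / 2 := by
    have : l ≤ c / 4 := min_le_left _ _
    linarith
  have hH : Integrable (fun t => 2 * p.threshold l t) μ :=
    ((h.memLp_threshold hl hl1).integrable one_le_two).const_mul 2
  set B : ℕ → Set Ω := fun n => {t | (f n).1 t ≠ 0}
  have hBm : ∀ n, MeasurableSet (B n) := fun n =>
    (f n).1.measurable (measurableSet_singleton (0 : ℝ)).compl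
  have hBd : Pairwise (Function.onFun (AEDisjoint μ) B) := by
    intro m n hmn
    refine measure_eq_zero_iff_ae_notMem.2 ?_
    filter_upwards [hdisj m n hmn] with t ht hmem
    exact ht.elim hmem.1 hmem.2
  -- Disjoint supports make these integrals summable, so some f n has L¹ norm at most c/2 + c/4 < c.
  have htsum : ∑' n, ∫⁻ t in B n, ENNReal.ofReal (2 * p.threshold l t) ∂μ ≠ ∞ := by
    rw [← lintegral_iUnion₀ (fun n => (hBm n).nullMeasurableSet) hBd]
    exact ((setLIntegral_le_lintegral _ _).trans_lt hH.lintegral_lt_top).ne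
  have hlim := ENNReal.tendsto_atTop_zero_of_tsum_ne_top htsum
  have hc4 : (0 : ℝ≥0∞) < ENNReal.ofReal (c / 4) := ENNReal.ofReal_pos.2 (by positivity)
  obtain ⟨n, hn⟩ := (hlim.eventually (gt_mem_nhds hc4)).exists
  have hlow := hiso (f n) (Submodule.le_topologicalClosure _ (Submodule.subset_span ⟨n, rfl⟩))
  rw [hf n, mul_one] at hlow
  set S := {t | p.threshold l t < |(f n).1 t / 2|}
  have hS : MeasurableSet S :=
    measurableSet_lt (p.measurable_threshold l) ((f n).1.measurable.div_const 2).abs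
  have hup : ∫⁻ t, ‖(f n).1 t‖ₑ ∂μ ≤ ENNReal.ofReal (c / 2) + ENNReal.ofReal (c / 4) := by
    rw [← lintegral_add_compl _ hS]
    refine add_le_add ((h.lintegral_large_le hl (hf n).le).trans
      (ENNReal.ofReal_le_ofReal hlc)) (le_trans ?_ hn.le)
    rw [← lintegral_indicator hS.compl, ← lintegral_indicator (hBm n)]
    refine lintegral_mono fun t => ?_
    by_cases hB : t ∈ B n
    · rw [indicator_of_mem hB]
      by_cases ht : t ∈ S
      · rw [indicator_of_notMem (by simpa using ht)]
        exact zero_le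
      · rw [indicator_of_mem (by simpa using ht), ← ofReal_norm]
        apply ENNReal.ofReal_le_ofReal
        have h1 : |(f n).1 t / 2| ≤ p.threshold l t := not_lt.1 ht
        rw [abs_div, abs_two, div_le_iff₀ two_pos] at h1
        rw [Real.norm_eq_abs]
        linarith
    · have h0 : (f n).1 t = 0 := not_not.1 hB
      by_cases ht : t ∈ Sᶜ <;> simp [ht, h0, hB]
  rw [← VarLp.enorm_inclusionL1, ← ENNReal.ofReal_add (by positivity) (by positivity),
    ENNReal.ofReal_le_ofReal_iff (by positivity)] at hup
  linarith

end Tails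

/-! ### Failure of the tails: disjoint sequences with constant integral -/

section DisjointSequences

open VarLebesgue

variable {Ω : Type*} [MeasurableSpace Ω] {μ : Measure Ω} {p : Exponent Ω}

/-- Integration over a set, as a functional on `L¹`. -/
noncomputable def setIntegralCLM (μ : Measure Ω) (S : Set Ω) : Lp ℝ 1 μ →L[ℝ] ℝ :=
  L1.integralCLM ∘L LpToLpRestrictCLM Ω ℝ ℝ μ 1 S

lemma setIntegralCLM_apply (S : Set Ω) (f : Lp ℝ 1 μ) :
    setIntegralCLM μ S f = ∫ t in S, f t ∂μ := by
  show L1.integralCLM (LpToLpRestrictCLM Ω ℝ ℝ μ 1 S f) = _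
  rw [← L1.integral_eq, L1.integral_eq_integral]
  exact integral_congr_ae (LpToLpRestrictCLM_coeFn ℝ S f)

lemma sum_abs_setIntegralCLM_le {A : ℕ → Set Ω} (hA : ∀ n, MeasurableSet (A n))
    (hd : Pairwise (Function.onFun Disjoint A)) (s : Finset ℕ) (f : Lp ℝ 1 μ) :
    ∑ n ∈ s, |setIntegralCLM μ (A n) f| ≤ ‖f‖ := by
  have hf : Integrable f μ := L1.integrable_coeFn f
  calc ∑ n ∈ s, |setIntegralCLM μ (A n) f| ≤ ∑ n ∈ s, ∫ t in A n, ‖f t‖ ∂μ := by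
        refine Finset.sum_le_sum fun n _ => ?_
        rw [setIntegralCLM_apply]
        exact norm_integral_le_integral_norm (f : Ω → ℝ)
    _ = ∫ t in ⋃ n ∈ s, A n, ‖f t‖ ∂μ :=
        (integral_biUnion_finset s (fun n _ => hA n) (hd.set_pairwise _)
          fun n _ => hf.norm.integrableOn).symm
    _ ≤ ∫ t, ‖f t‖ ∂μ := setIntegral_le_integral hf.norm (ae_of_all _ fun t => norm_nonneg _)
    _ = ‖f‖ := (L1.norm_eq_integral_norm f).symm

variable [IsFiniteMeasure μ]

lemma IsAtomless.exists_pairwise_disjoint (hμ : IsAtomless μ) {S : Set Ω} (hS : MeasurableSet S)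
    (h0 : 0 < μ S) : ∃ A : ℕ → Set Ω, (∀ n, MeasurableSet (A n)) ∧ Pairwise (Function.onFun Disjoint A) ∧
      ∀ n, A n ⊆ S ∧ 0 < μ (A n) := by
  let X := {s : Set Ω // s ⊆ S ∧ MeasurableSet s ∧ 0 < μ s}
  have step : ∀ s : X, ∃ t : X, t.1 ⊆ s.1 ∧ 0 < μ (s.1 \ t.1) := by
    rintro ⟨s, hsS, hs, hs0⟩
    obtain ⟨t, hts, ht, ht0, hlt⟩ := hμ s hs hs0
    refine ⟨⟨t, hts.trans hsS, ht, ht0⟩, hts, ?_⟩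
    show 0 < μ (s \ t)
    rw [measure_sdiff hts ht.nullMeasurableSet (measure_ne_top _ _)]
    exact tsub_pos_of_lt hlt
  choose F hF using step
  let u : ℕ → X := fun n => Nat.rec ⟨S, Subset.rfl, hS, h0⟩ (fun _ s => F s) n
  have hu : ∀ n, u (n + 1) = F (u n) := fun n => rfl
  have hanti : Antitone fun n => (u n).1 := antitone_nat_of_succ_le fun n => by
    rw [hu]; exact (hF (u n)).1
  refine ⟨fun n => (u n).1 \ (u (n + 1)).1, fun n => (u n).2.2.1.diff (u (n + 1)).2.2.1, ?_,
    fun n => ⟨sdiff_subset.trans (u n).2.1, ?_⟩⟩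
  · refine (pairwise_disjoint_on _).2 fun m n hmn => ?_
    exact disjoint_sdiff_left.mono_right (sdiff_subset.trans (hanti (Nat.succ_le_of_lt hmn)))
  · exact (hF (u n)).2

lemma measureReal_tail_tendsto_zero (h1 : μ {t | p t = 1} = 0) (s : ℝ) :
    Tendsto (fun n : ℕ => μ.real {t | (s + n) * (p t - 1) ≤ p t}) atTop (𝓝 0) := by
  have hinter : ⋂ n : ℕ, {t | (s + n) * (p t - 1) ≤ p t} ⊆ {t | p t = 1} := by
    intro t ht
    rw [mem_iInter] at ht
    by_contra hne
    have hp : 0 < p t - 1 := sub_pos.2 (lt_of_le_of_ne (p.one_le t) (Ne.symm hne))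
    obtain ⟨n, hn⟩ := exists_nat_gt (p t / (p t - 1) - s)
    have := ht n
    rw [mem_ofPred_eq, ← le_div_iff₀ hp] at this
    linarith
  have := tendsto_measure_iInter_atTop (μ := μ)
    (s := fun n : ℕ => {t | (s + n) * (p t - 1) ≤ p t})
    (fun n => (p.measurableSet_tail _).nullMeasurableSet)
    (fun m n hmn => p.tail_anti (by gcongr)) ⟨0, measure_ne_top _ _⟩
  rw [measure_mono_null hinter h1] at this
  have h2 := (ENNReal.tendsto_toReal ENNReal.zero_ne_top).comp this
  exact h2

/-- With v = (am)⁻¹ < a^(s-1), the tail inequality reads (s-1)(p-1) ≤ 1, so v^(p-1) ≤ a. -/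
lemma rpow_le_of_mem_tail {a s m : ℝ} (ha : 1 < a) (hm : a ^ (-s) < m) {t : Ω}
    (ht : s * (p t - 1) ≤ p t) : (a * m)⁻¹ ^ p t ≤ a * (a * m)⁻¹ := by
  have ha0 : 0 < a := by linarith
  have hm0 : 0 < m := lt_trans (by positivity) hm
  have hp := p.one_le t
  set v := (a * m)⁻¹ with hv
  have hv0 : 0 < v := by positivity
  have key : v ^ (p t - 1) ≤ a := by
    rcases le_total v 1 with h | h
    · exact (Real.rpow_le_one hv0.le h (by linarith)).trans ha.le
    · have h1 : v ≤ a ^ (s - 1) := by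
        rw [hv, show s - 1 = -(1 + -s) by ring, Real.rpow_neg ha0.le, Real.rpow_add ha0,
          Real.rpow_one]
        gcongr
      calc v ^ (p t - 1) ≤ (a ^ (s - 1)) ^ (p t - 1) :=
            Real.rpow_le_rpow hv0.le h1 (by linarith)
        _ = a ^ ((s - 1) * (p t - 1)) := (Real.rpow_mul ha0.le _ _).symm
        _ ≤ a ^ (1 : ℝ) := Real.rpow_le_rpow_of_exponent_le ha.le (by linarith)
        _ = a := Real.rpow_one a
  calc v ^ p t = v ^ (p t - 1) * v := by rw [← Real.rpow_add_one hv0.ne', sub_add_cancel]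
    _ ≤ a * v := by gcongr

lemma exists_tail_diff (hC : ¬ HasExpTails p μ) (h1 : μ {t | p t = 1} = 0) :
    ∃ a : ℝ, 1 < a ∧ ∀ T : ℝ, ∃ s t : ℝ, T ≤ s ∧ s ≤ t ∧
      a ^ (-s) < μ.real ({x | s * (p x - 1) ≤ p x} \ {x | t * (p x - 1) ≤ p x}) := by
  unfold HasExpTails at hC
  push Not at hC
  obtain ⟨a, ha, hC⟩ := hC
  have ha0 : 0 < a := by linarith
  refine ⟨a, ha, fun T => ?_⟩
  set M := μ.real univ
  -- Tails never exceed M, so violating the bound with constant M a^T forces s ≥ T; the 1 keeps the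
  -- tail above a^(-s).
  obtain ⟨s, hs, hsC⟩ := hC (max 1 (M * a ^ T)) (by positivity)
  have hle : μ.real {t | s * (p t - 1) ≤ p t} ≤ M := measureReal_mono (subset_univ _)
  have hpos : 0 < a ^ (-s) := by positivity
  have hTs : T ≤ s := by
    by_contra! hlt
    have h2 : M * a ^ T * a ^ (-s) < M := by
      refine lt_of_le_of_lt ?_ (hsC.trans_le hle)
      gcongr
      exact le_max_right _ _
    have h3 : 1 ≤ a ^ T * a ^ (-s) := by
      rw [← Real.rpow_add ha0]
      exact Real.one_le_rpow ha.le (by linarith)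
    have hM : 0 ≤ M := measureReal_nonneg
    nlinarith
  have h4 : a ^ (-s) < μ.real {t | s * (p t - 1) ≤ p t} := by
    refine lt_of_le_of_lt ?_ hsC
    exact le_mul_of_one_le_left hpos.le (le_max_left _ _)
  obtain ⟨n, hn⟩ := ((measureReal_tail_tendsto_zero h1 s).eventually
    (gt_mem_nhds (sub_pos.2 h4))).exists
  refine ⟨s, s + n, hTs, by simp, ?_⟩
  rw [measureReal_sdiff (p.tail_anti (by simp)) (p.measurableSet_tail _)]
  linarith

/-- If the tails of `p / (p - 1)` are not exponentially small, there are normalized multiples of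
indicators of disjoint sets in `L^{p(·)}` with constant `L¹` norm. -/
lemma exists_disjoint_sets (hμ : IsAtomless μ) (hC : ¬ HasExpTails p μ) :
    ∃ K : ℝ, 1 < K ∧ ∃ A : ℕ → Set Ω, (∀ n, MeasurableSet (A n)) ∧ Pairwise (Function.onFun Disjoint A) ∧
      ∀ n, 0 < μ.real (A n) ∧
        ∀ t ∈ A n, (K * μ.real (A n))⁻¹ ^ p t ≤ K * (K * μ.real (A n))⁻¹ := by
  -- If {p = 1} is null, the tails shrink to measure 0 and successive differences of tails serve as
  -- the sets. Otherwise atomlessness splits {p = 1}, where the power is trivial.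
  by_cases h1 : μ {t | p t = 1} = 0
  · obtain ⟨a, ha, step⟩ := exists_tail_diff hC h1
    choose σ τ hσ hστ hμσ using step
    let T : ℕ → ℝ := fun n => Nat.rec 0 (fun _ x => τ x) n
    have hT : ∀ n, T (n + 1) = τ (T n) := fun n => rfl
    have hmono : Monotone T := monotone_nat_of_le_succ fun n => by
      rw [hT]; exact (hσ _).trans (hστ _)
    refine ⟨a, ha, fun n => {x | σ (T n) * (p x - 1) ≤ p x} \ {x | τ (T n) * (p x - 1) ≤ p x},
      fun n => (p.measurableSet_tail _).diff (p.measurableSet_tail _), ?_, fun n => ⟨?_, ?_⟩⟩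
    · refine (pairwise_disjoint_on _).2 fun m n hmn => ?_
      refine disjoint_sdiff_left.mono_right (sdiff_subset.trans (p.tail_anti ?_))
      rw [← hT]
      exact (hmono (Nat.succ_le_of_lt hmn)).trans (hσ _)
    · exact lt_trans (by positivity) (hμσ (T n))
    · exact fun t ht => rpow_le_of_mem_tail ha (hμσ (T n)) ht.1
  · have hS : MeasurableSet {t | p t = 1} := p.measurable (measurableSet_singleton 1)
    obtain ⟨A, hA, hd, hAS⟩ := hμ.exists_pairwise_disjoint hS (pos_iff_ne_zero.2 h1)
    refine ⟨2, one_lt_two, A, hA, hd, fun n =>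
      ⟨ENNReal.toReal_pos (hAS n).2.ne' (measure_ne_top _ _), fun t ht => ?_⟩⟩
    have hp : p t = 1 := (hAS n).1 ht
    rw [hp, Real.rpow_one]
    have : (0 : ℝ) ≤ (2 * μ.real (A n))⁻¹ := by positivity
    linarith

/-- The height v = 1/(K μ(A)) makes the modular at most K v μ(A) = 1 and the integral exactly 1/K.
-/
lemma exists_disjoint_sequence (hμ : IsAtomless μ) (hC : ¬ HasExpTails p μ) :
    ∃ c : ℝ, 0 < c ∧ ∃ (A : ℕ → Set Ω) (v : ℕ → ℝ) (g : ℕ → VarLp p μ),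
      (∀ n, MeasurableSet (A n)) ∧ Pairwise (Function.onFun Disjoint A) ∧ (∀ n, ‖g n‖ ≤ 1) ∧
      (∀ n, (g n).1 =ᵐ[μ] (A n).indicator fun _ => v n) ∧ ∀ n, μ.real (A n) * v n = c := by
  obtain ⟨K, hK, A, hA, hd, hAK⟩ := exists_disjoint_sets hμ hC
  have hK0 : 0 < K := by linarith
  set v : ℕ → ℝ := fun n => (K * μ.real (A n))⁻¹
  have hv : ∀ n, 0 < v n := fun n => by have := (hAK n).1; positivity
  set x : ℕ → Ω → ℝ := fun n => (A n).indicator fun _ => v n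
  have hx : ∀ n, AEStronglyMeasurable (x n) μ := fun n =>
    (measurable_const.indicator (hA n)).aestronglyMeasurable
  have hmod : ∀ n, modular p μ (fun t => AEEqFun.mk (x n) (hx n) t / 1) ≤ 1 := by
    intro n
    rw [modular_div_congr (AEEqFun.coeFn_mk (x n) (hx n))]
    simp only [div_one]
    calc modular p μ (x n)
        ≤ ∫⁻ t, (A n).indicator (fun _ => ENNReal.ofReal (K * v n)) t ∂μ := by
          refine lintegral_mono fun t => ?_
          have hp : 0 < p t := zero_lt_one.trans_le (p.one_le t)
          by_cases ht : t ∈ A n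
          · simp only [x, indicator_of_mem ht]
            rw [Real.enorm_of_nonneg (hv n).le, ENNReal.ofReal_rpow_of_pos (hv n)]
            exact ENNReal.ofReal_le_ofReal ((hAK n).2 t ht)
          · simp [x, indicator_of_notMem ht, hp]
      _ = ENNReal.ofReal (K * v n) * ENNReal.ofReal (μ.real (A n)) := by
          rw [lintegral_indicator_const (hA n), ofReal_measureReal]
      _ = 1 := by
          have h0 := (hAK n).1.ne'
          rw [← ENNReal.ofReal_mul (mul_nonneg hK0.le (hv n).le), ENNReal.ofReal_eq_one]
          simp only [v]
          field_simp
  refine ⟨K⁻¹, inv_pos.2 hK0, A, v,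
    fun n => ⟨AEEqFun.mk (x n) (hx n), 1, one_pos, (hmod n).trans_lt ENNReal.one_lt_top⟩,
    hA, hd, fun n => ?_, fun n => AEEqFun.coeFn_mk (x n) (hx n), fun n => ?_⟩
  · exact csInf_le admissible_bddBelow ⟨one_pos, hmod n⟩
  · have h0 := (hAK n).1.ne'
    simp only [v]
    field_simp

lemma setIntegralCLM_inclusionL1 {g : VarLp p μ} {A : Set Ω} (hA : MeasurableSet A) {v : ℝ}
    (hg : g.1 =ᵐ[μ] A.indicator fun _ => v) (S : Set Ω) :
    setIntegralCLM μ S (VarLp.inclusionL1 p μ g) = μ.real (A ∩ S) * v := by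
  rw [setIntegralCLM_apply]
  have h : (VarLp.inclusionL1 p μ g : Ω → ℝ) =ᵐ[μ] A.indicator fun _ => v := hg
  rw [integral_congr_ae (ae_restrict_of_ae h), integral_indicator_const _ hA,
    measureReal_restrict_apply hA, smul_eq_mul]

theorem hasExpTails_of_isWeaklyCompactOperator (hμ : IsAtomless μ)
    (h : IsWeaklyCompactOperator (VarLp.inclusionL1 p μ)) : HasExpTails p μ := by
  by_contra hC
  obtain ⟨c, hc, A, v, g, hA, hd, hg1, hg, hAv⟩ := exists_disjoint_sequence hμ hC
  set z : ℕ → WeakSpace ℝ (Lp ℝ 1 μ) := fun n => toWeakSpace ℝ _ (VarLp.inclusionL1 p μ (g n))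
  have hz : ∀ n, z n ∈ closure (toWeakSpace ℝ (Lp ℝ 1 μ) ''
      (VarLp.inclusionL1 p μ '' Metric.closedBall 0 1)) := fun n =>
    subset_closure ⟨_, ⟨g n, by simpa using hg1 n, rfl⟩, rfl⟩
  obtain ⟨y, -, hy⟩ := h (f := map z atTop) (tendsto_principal.2 (Eventually.of_forall hz))
  -- An ultrafilter finer than `atTop` replaces a weakly convergent subsequence. Its limit has
  -- integral c over every S N, although these sets decrease to ∅.
  obtain ⟨U, hU, hUy⟩ := mapClusterPt_iff_ultrafilter.1 hy
  set y' : Lp ℝ 1 μ := (toWeakSpace ℝ (Lp ℝ 1 μ)).symm y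
  set S : ℕ → Set Ω := fun N => ⋃ n ≥ N, A n
  have hS : ∀ N, MeasurableSet (S N) := fun N =>
    MeasurableSet.iUnion fun n => MeasurableSet.iUnion fun _ => hA n
  have hval : ∀ N, setIntegralCLM μ (S N) y' = c := by
    intro N
    have hcont : Continuous fun x : WeakSpace ℝ (Lp ℝ 1 μ) =>
        setIntegralCLM μ (S N) ((toWeakSpace ℝ (Lp ℝ 1 μ)).symm x) :=
      WeakBilin.eval_continuous (topDualPairing ℝ (Lp ℝ 1 μ)).flip (setIntegralCLM μ (S N))
    have h1 := (hcont.tendsto y).comp hUy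
    refine tendsto_nhds_unique h1 (tendsto_const_nhds.congr' ?_)
    filter_upwards [hU (eventually_ge_atTop N)] with n hn
    have e : setIntegralCLM μ (S N) (VarLp.inclusionL1 p μ (g n)) = c := by
      rw [setIntegralCLM_inclusionL1 (hA n) (hg n), inter_eq_left.2, hAv]
      exact subset_biUnion_of_mem (u := A) hn
    exact e.symm
  have hanti : Antitone S := fun M N hMN =>
    biUnion_subset_biUnion_left fun n hn => le_trans hMN hn
  have hempty : ⋂ N, S N = ∅ := by
    refine eq_empty_of_forall_notMem fun t ht => ?_
    rw [mem_iInter] at ht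
    obtain ⟨m, -, hm⟩ := mem_iUnion₂.1 (ht 0)
    obtain ⟨n, hn, hn'⟩ := mem_iUnion₂.1 (ht (m + 1))
    exact disjoint_left.1 (hd (show m ≠ n by have : m + 1 ≤ n := hn; omega)) hm hn'
  have hlim := tendsto_setIntegral_of_antitone hS hanti
    ⟨0, (L1.integrable_coeFn y').integrableOn⟩
  rw [hempty, setIntegral_empty] at hlim
  have := tendsto_nhds_unique hlim
    (tendsto_const_nhds.congr fun N => ((setIntegralCLM_apply (S N) y').symm.trans (hval N)).symm)
  exact hc.ne this

theorem hasExpTails_of_isDisjointlyStrictlySingular (hμ : IsAtomless μ)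
    (h : IsDisjointlyStrictlySingular (VarLp.inclusionL1 p μ)) : HasExpTails p μ := by
  by_contra hC
  obtain ⟨c, hc, A, v, g, hA, hd, hg1, hg, hAv⟩ := exists_disjoint_sequence hμ hC
  set T := VarLp.inclusionL1 p μ
  have hφ : ∀ m n, setIntegralCLM μ (A m) (T (g n)) = if m = n then c else 0 := by
    intro m n
    rw [setIntegralCLM_inclusionL1 (hA n) (hg n)]
    split_ifs with hmn
    · rw [hmn, inter_self, hAv]
    · rw [(hd (Ne.symm hmn)).inter_eq]; simp
  -- Comparison with ℓ¹: the norm of x is at most the sum of |b i|, while integrating over the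
  -- disjoint sets bounds the L¹ norm below by c times that sum.
  have hspan : ∀ x ∈ Submodule.span ℝ (range g), c * ‖x‖ ≤ ‖T x‖ := by
    intro x hx
    obtain ⟨b, rfl⟩ := (Finsupp.mem_span_range_iff_exists_finsupp).1 hx
    rw [Finsupp.sum]
    have hn : ‖∑ i ∈ b.support, b i • g i‖ ≤ ∑ i ∈ b.support, |b i| := by
      refine norm_sum_le_of_le _ fun i _ => ?_
      rw [norm_smul, Real.norm_eq_abs]
      exact mul_le_of_le_one_right (abs_nonneg _) (hg1 i)
    have hT : ∀ j ∈ b.support, |setIntegralCLM μ (A j) (T (∑ i ∈ b.support, b i • g i))| =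
        c * |b j| := by
      intro j hj
      rw [map_sum, map_sum, Finset.sum_eq_single_of_mem j hj]
      · rw [map_smul, map_smul, hφ, if_pos rfl, smul_eq_mul, abs_mul, abs_of_pos hc, mul_comm]
      · intro i _ hij
        rw [map_smul, map_smul, hφ, if_neg (Ne.symm hij), smul_zero]
    calc c * ‖∑ i ∈ b.support, b i • g i‖ ≤ c * ∑ i ∈ b.support, |b i| := by gcongr
      _ = ∑ j ∈ b.support, |setIntegralCLM μ (A j) (T (∑ i ∈ b.support, b i • g i))| := by
          rw [Finset.mul_sum]
          exact (Finset.sum_congr rfl hT).symm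
      _ ≤ _ := sum_abs_setIntegralCLM_le hA hd _ _
  have hg0 : ∀ n, g n ≠ 0 := by
    intro n h0
    have := hφ n n
    rw [h0, map_zero, map_zero, if_pos rfl] at this
    exact hc.ne this
  -- The g n have norm at most 1, not exactly 1. Normalizing stays inside their span, so c survives.
  refine h (fun n => ‖g n‖⁻¹ • g n) (fun n => norm_smul_inv_norm (𝕜 := ℝ) (hg0 n)) ?_ ⟨c, hc, ?_⟩
  · intro m n hmn
    have e : ∀ k, ⇑((‖g k‖⁻¹ • g k : VarLp p μ) : Ω →ₘ[μ] ℝ) =ᵐ[μ] fun t => ‖g k‖⁻¹ * (g k).1 t :=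
      fun k => AEEqFun.coeFn_smul _ (g k).1
    filter_upwards [e m, e n, hg m, hg n] with t h1 h2 h3 h4
    rw [h1, h2, h3, h4]
    by_cases ht : t ∈ A m
    · right
      rw [indicator_of_notMem (disjoint_left.1 (hd hmn) ht), mul_zero]
    · left
      rw [indicator_of_notMem ht, mul_zero]
  · have hclosed : IsClosed {x : VarLp p μ | c * ‖x‖ ≤ ‖T x‖} :=
      isClosed_le (continuous_const.mul continuous_norm) T.continuous.norm
    refine closure_minimal (fun x hx => hspan x ?_) hclosed
    refine Submodule.span_le.2 ?_ hx
    rintro _ ⟨n, rfl⟩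
    exact Submodule.smul_mem _ _ (Submodule.subset_span ⟨n, rfl⟩)

end DisjointSequences

/-! ### The equivalence, through the tail condition -/

theorem corollary4p2 {Ω : Type*} [MeasurableSpace Ω] (μ : Measure Ω) [IsFiniteMeasure μ]
    (hμ : IsAtomless μ) (p : Exponent Ω) :
    List.TFAE [
      ∀ a : ℝ, 1 < a →
        ∫⁻ x in Ioo 0 (μ.real univ), extPow a (decreasingRearrangement μ p.conj x) < ∞,
      IsWeaklyCompactOperator (VarLp.inclusionL1 p μ),
      IsDisjointlyStrictlySingular (VarLp.inclusionL1 p μ),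
      Tendsto
        (fun x : ℝ => (μ.real univ - x) ^ (decreasingRearrangement μ p.conjInv x).toReal)
        (𝓝[Ico 0 (μ.real univ)] (μ.real univ)) (𝓝 0)] := by
  have h1 : (∀ a : ℝ, 1 < a → ∫⁻ x in Ioo 0 (μ.real univ),
      extPow a (decreasingRearrangement μ p.conj x) < ∞) ↔ HasExpTails p μ :=
    ⟨hasExpTails_of_integral_rearrangement, fun h _ => h.integral_rearrangement⟩
  have h2 : IsWeaklyCompactOperator (VarLp.inclusionL1 p μ) ↔ HasExpTails p μ :=
    ⟨hasExpTails_of_isWeaklyCompactOperator hμ, HasExpTails.isWeaklyCompactOperator⟩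
  have h3 : IsDisjointlyStrictlySingular (VarLp.inclusionL1 p μ) ↔ HasExpTails p μ :=
    ⟨hasExpTails_of_isDisjointlyStrictlySingular hμ, HasExpTails.isDisjointlyStrictlySingular⟩
  rw [h1, h2, h3]
  tfae_have 1 ↔ 2 := Iff.rfl
  tfae_have 1 ↔ 3 := Iff.rfl
  tfae_have 1 ↔ 4 := ⟨HasExpTails.tendsto, hasExpTails_of_tendsto⟩
  tfae_finish
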